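/- Let $\mathbb D=\{z\in\mathbb C:|z|<1\}$, let $\gamma>-1$ be real, and let $L^{2,\gamma}(\mathbb D)=L^2(\mathbb D,(1-|z|^2)^\gamma\,dx\,dy)$ be the Hilbert space of (classes of) complex-valued functions on $\mathbb D$ that are square integrable with respect to the measure $(1-|z|^2)^\gamma\,dx\,dy$. Put $\partial_{\bar z}=\frac12(\partial_x+i\partial_y)$. A function $f:\mathbb D\to\mathbb C$ is called polyanalytic of order $N$ if it is of class $C^N$ (in the real sense) and $\partial_{\bar z}^{N}f=0$ on $\mathbb D$. For an integer $n\ge 0$, the weighted poly-Bergman space $A^{2,\gamma}_n(\mathbb D)=\{F\in L^{2,\gamma}(\mathbb D):\partial_{\bar z}^{\,n+1}F=0\}$ is the space of those $F\in L^{2,\gamma}(\mathbb D)$ that agree almost everywhere with a polyanalytic function of order $n+1$. For integers $m,k\ge 0$, the disc polynomial $R^\gamma_{m,k}$ is $$R^\gamma_{m,k}(z,\bar z)=\frac{z^m\bar z^k}{|z|^{2\min(m,k)}}\,P^{(\gamma,|m-k|)}_{\min(m,k)}(2|z|^2-1),$$ extended continuously to $z=0$, where $P^{(\alpha,\beta)}_j$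 is the Jacobi polynomial of degree $j$ normalized by $P^{(\alpha,\beta)}_j(1)=1$. Then, for every $n\ge 0$, $A^{2,\gamma}_n(\mathbb D)$ is a closed linear subspace of $L^{2,\gamma}(\mathbb D)$, and it equals the closure in $L^{2,\gamma}(\mathbb D)$ of the linear span of the disc polynomials $R^\gamma_{m,k}$ with $m\ge 0$ and $0\le k\le n$. -/

import Mathlib

open MeasureTheory Set
open scoped ComplexConjugate ENNReal ContDiff

namespace PolyBergman

/-- The open unit disc of the complex plane. -/
abbrev disc : Set ℂ := Metric.ball (0 : ℂ) 1

/-- The weighted measure `(1 - |z|²)^γ dx dy` on the unit disc, viewed as a measure on `ℂ` that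
does not charge the complement of the disc. -/
noncomputable def diskMeasure (γ : ℝ) : Measure ℂ :=
  (volume.restrict disc).withDensity fun z => ENNReal.ofReal ((1 - ‖z‖ ^ 2) ^ γ)

/-- The Hilbert space of classes of complex-valued functions on the unit disc that are square
integrable with respect to `(1 - |z|²)^γ dx dy`. -/
noncomputable abbrev WeightedL2 (γ : ℝ) : Type :=
  Lp ℂ 2 (diskMeasure γ)

/-- The Wirtinger operator `∂/∂z̄ = (∂/∂x + i ∂/∂y) / 2`. -/
noncomputable def dbar (f : ℂ → ℂ) (z : ℂ) : ℂ :=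
  (1 / 2 : ℂ) * (fderiv ℝ f z 1 + Complex.I * fderiv ℝ f z Complex.I)

/-- Polyanalytic functions of order `N` on the unit disc: functions of class `C^N` on the disc
that solve the generalized Cauchy equation `(∂/∂z̄)^N f = 0` there. The values of `f` outside the
(open) disc play no role. -/
def IsPolyanalytic (N : ℕ) (f : ℂ → ℂ) : Prop :=
  ContDiffOn ℝ N f disc ∧ ∀ z ∈ disc, (dbar^[N]) f z = 0

/-- The Jacobi polynomial `P_k^{(α,β)}`, normalized by `P_k^{(α,β)}(1) = 1`, that is
`₂F₁(-k, k + α + β + 1; α + 1; (1 - x) / 2)`. -/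
noncomputable def jacobi (α β : ℝ) (k : ℕ) (x : ℝ) : ℝ :=
  ∑ j ∈ Finset.range (k + 1),
    (k.choose j : ℝ) * (ascPochhammer ℝ j).eval ((k : ℝ) + α + β + 1)
      / (ascPochhammer ℝ j).eval (α + 1) * ((x - 1) / 2) ^ j

/-- The disc polynomial
`R^γ_{m,k}(z, z̄) = z^m z̄^k / |z|^(2 min(m,k)) * P^{(γ,|m-k|)}_{min(m,k)}(2|z|² - 1)`.
The quotient `z^m z̄^k / |z|^(2 min(m,k))` is written without its removable singularity at `0`:
it is `z^(m-k)` if `k ≤ m` and `z̄^(k-m)` if `m ≤ k` (the subtractions in the two exponents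
below are truncated). -/
noncomputable def discPoly (γ : ℝ) (m k : ℕ) (z : ℂ) : ℂ :=
  z ^ (m - k) * conj z ^ (k - m) *
    (jacobi γ |(m : ℝ) - (k : ℝ)| (min m k) (2 * ‖z‖ ^ 2 - 1) : ℝ)

/-! Linearity of the iterated Wirtinger operator on smooth functions, needed to see that the
weighted poly-Bergman space is a linear subspace. -/

theorem dbar_congr {f g : ℂ → ℂ} (h : EqOn f g disc) : EqOn (dbar f) (dbar g) disc := by
  intro z hz
  have : f =ᶠ[nhds z] g := h.eventuallyEq_of_mem (Metric.isOpen_ball.mem_nhds hz)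
  simp only [dbar, this.fderiv_eq]

theorem dbar_iterate_congr (N : ℕ) {f g : ℂ → ℂ} (h : EqOn f g disc) :
    EqOn (dbar^[N] f) (dbar^[N] g) disc := by
  induction N generalizing f g with
  | zero => simpa using h
  | succ N ih => simpa only [Function.iterate_succ, Function.comp] using ih (dbar_congr h)

theorem differentiableAt_of_contDiffOn {N : ℕ} {f : ℂ → ℂ}
    (hf : ContDiffOn ℝ ((N + 1 : ℕ) : ℕ∞ω) f disc) {z : ℂ} (hz : z ∈ disc) :
    DifferentiableAt ℝ f z :=
  (hf.contDiffAt (Metric.isOpen_ball.mem_nhds hz)).differentiableAt (by simp)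

theorem contDiffOn_dbar {N : ℕ} {f : ℂ → ℂ} (hf : ContDiffOn ℝ ((N + 1 : ℕ) : ℕ∞ω) f disc) :
    ContDiffOn ℝ (N : ℕ∞ω) (dbar f) disc := by
  have h : ContDiffOn ℝ (N : ℕ∞ω) (fderiv ℝ f) disc :=
    hf.fderiv_of_isOpen Metric.isOpen_ball (by push_cast; exact le_rfl)
  have h1 := h.clm_apply (contDiffOn_const (c := (1 : ℂ)))
  have h2 := h.clm_apply (contDiffOn_const (c := Complex.I))
  exact contDiffOn_const.mul (h1.add (contDiffOn_const.mul h2))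

theorem dbar_iterate_add (N : ℕ) {f g : ℂ → ℂ} (hf : ContDiffOn ℝ (N : ℕ∞ω) f disc)
    (hg : ContDiffOn ℝ (N : ℕ∞ω) g disc) :
    EqOn (dbar^[N] (f + g)) (dbar^[N] f + dbar^[N] g) disc := by
  induction N generalizing f g with
  | zero => intro z _; simp
  | succ N ih =>
    have h : EqOn (dbar (f + g)) (dbar f + dbar g) disc := by
      intro z hz
      simp only [dbar, Pi.add_apply]
      rw [fderiv_add (differentiableAt_of_contDiffOn hf hz)
        (differentiableAt_of_contDiffOn hg hz)]
      simp only [_root_.add_apply]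
      ring
    simp only [Function.iterate_succ, Function.comp]
    exact (dbar_iterate_congr N h).trans (ih (contDiffOn_dbar hf) (contDiffOn_dbar hg))

theorem dbar_iterate_smul (N : ℕ) (c : ℂ) {f : ℂ → ℂ} (hf : ContDiffOn ℝ (N : ℕ∞ω) f disc) :
    EqOn (dbar^[N] (c • f)) (c • dbar^[N] f) disc := by
  induction N generalizing f with
  | zero => intro z _; simp
  | succ N ih =>
    have h : EqOn (dbar (c • f)) (c • dbar f) disc := by
      intro z hz
      simp only [dbar, Pi.smul_apply]
      rw [fderiv_const_smul (differentiableAt_of_contDiffOn hf hz)]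
      simp only [_root_.smul_apply, smul_eq_mul]
      ring
    simp only [Function.iterate_succ, Function.comp]
    exact (dbar_iterate_congr N h).trans (ih (contDiffOn_dbar hf))

theorem isPolyanalytic_zero (N : ℕ) : IsPolyanalytic N 0 := by
  refine ⟨contDiffOn_const, fun z hz => ?_⟩
  have := dbar_iterate_smul N 0 (f := 0) contDiffOn_const hz
  simpa using this

theorem IsPolyanalytic.add {N : ℕ} {f g : ℂ → ℂ} (hf : IsPolyanalytic N f)
    (hg : IsPolyanalytic N g) : IsPolyanalytic N (f + g) := by
  refine ⟨hf.1.add hg.1, fun z hz => ?_⟩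
  rw [dbar_iterate_add N hf.1 hg.1 hz, Pi.add_apply, hf.2 z hz, hg.2 z hz, add_zero]

theorem IsPolyanalytic.smul {N : ℕ} (c : ℂ) {f : ℂ → ℂ} (hf : IsPolyanalytic N f) :
    IsPolyanalytic N (c • f) := by
  refine ⟨contDiffOn_const.smul hf.1, fun z hz => ?_⟩
  rw [dbar_iterate_smul N c hf.1 hz, Pi.smul_apply, hf.2 z hz, smul_zero]

/-- The weighted poly-Bergman space: the classes in the weighted `L²` space of the disc that
contain a polyanalytic function of order `n + 1`. -/
noncomputable def polyBergman (γ : ℝ) (n : ℕ) : Submodule ℂ (WeightedL2 γ) where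
  carrier := {F | ∃ f : ℂ → ℂ, IsPolyanalytic (n + 1) f ∧ F =ᵐ[diskMeasure γ] f}
  zero_mem' := ⟨0, isPolyanalytic_zero _, Lp.coeFn_zero _ _ _⟩
  add_mem' := by
    rintro F G ⟨f, hf, hFf⟩ ⟨g, hg, hGg⟩
    exact ⟨f + g, hf.add hg, (Lp.coeFn_add F G).trans (hFf.add hGg)⟩
  smul_mem' := by
    rintro c F ⟨f, hf, hFf⟩
    exact ⟨c • f, hf.smul c, (Lp.coeFn_smul c F).trans (hFf.const_smul c)⟩

/-! The disc polynomials are square integrable for `γ > -1`. -/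

theorem integrableOn_weight {γ : ℝ} (hγ : -1 < γ) :
    IntegrableOn (fun z : ℂ => (1 - ‖z‖ ^ 2) ^ γ) disc := by
  have key : IntegrableOn (fun r : ℝ => r * (1 - r ^ 2) ^ γ) (Ioo 0 1) := by
    have h1 : IntervalIntegrable (fun r : ℝ => (1 - r) ^ γ) volume 0 1 := by
      simpa using
        (intervalIntegral.intervalIntegrable_rpow' (a := 1) (b := 0) hγ).comp_sub_left 1
    have h2 : ContinuousOn (fun r : ℝ => r * (1 + r) ^ γ) (uIcc 0 1) := by
      rw [uIcc_of_le zero_le_one]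
      refine continuousOn_id.mul ((continuousOn_const.add continuousOn_id).rpow_const ?_)
      intro r hr
      exact Or.inl (ne_of_gt (add_pos_of_pos_of_nonneg one_pos hr.1))
    have h3 := h1.mul_continuousOn h2
    rw [intervalIntegrable_iff_integrableOn_Ioo_of_le zero_le_one] at h3
    refine h3.congr_fun (fun r hr => ?_) measurableSet_Ioo
    have : (1 - r ^ 2) = (1 - r) * (1 + r) := by ring
    simp only [this]
    rw [Real.mul_rpow (by linarith [hr.2]) (by linarith [hr.1])]
    ring
  let φ : ℝ → ℝ := (Iio 1).indicator fun r => (1 - r ^ 2) ^ γ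
  have h : Integrable (fun z : ℂ => φ ‖z‖) := by
    rw [integrable_fun_norm_addHaar (E := ℂ) volume (f := φ), Complex.finrank_real_complex]
    have e : (fun y : ℝ => y ^ (2 - 1) • φ y)
        = (Iio 1).indicator fun r => r * (1 - r ^ 2) ^ γ := by
      ext y
      by_cases hy : y ∈ Iio (1 : ℝ) <;> simp [φ, hy]
    rw [e, IntegrableOn, integrable_indicator_iff measurableSet_Iio, IntegrableOn,
      Measure.restrict_restrict measurableSet_Iio, inter_comm, Ioi_inter_Iio]
    exact key
  refine h.integrableOn.congr_fun (s := disc) (fun z hz => ?_) measurableSet_ball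
  have : ‖z‖ < 1 := by simpa using hz
  simp [φ, this]

theorem isFiniteMeasure_diskMeasure {γ : ℝ} (hγ : -1 < γ) :
    IsFiniteMeasure (diskMeasure γ) :=
  isFiniteMeasure_withDensity_ofReal (integrableOn_weight hγ).2

theorem continuous_discPoly (γ : ℝ) (m k : ℕ) : Continuous (discPoly γ m k) := by
  have h : Continuous (jacobi γ |(m : ℝ) - (k : ℝ)| (min m k)) := by
    unfold jacobi
    fun_prop
  have h' : Continuous fun z : ℂ =>
      jacobi γ |(m : ℝ) - (k : ℝ)| (min m k) (2 * ‖z‖ ^ 2 - 1) :=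
    h.comp (by fun_prop)
  have h'' := Complex.continuous_ofReal.comp h'
  exact (((continuous_id.pow _).mul (Complex.continuous_conj.pow _))).mul h''

theorem memLp_discPoly {γ : ℝ} (hγ : -1 < γ) (m k : ℕ) :
    MemLp (discPoly γ m k) 2 (diskMeasure γ) := by
  have := isFiniteMeasure_diskMeasure hγ
  obtain ⟨C, hC⟩ := (isCompact_closedBall (0 : ℂ) 1).exists_bound_of_continuousOn
    (continuous_discPoly γ m k).continuousOn
  refine MemLp.of_bound (continuous_discPoly γ m k).aestronglyMeasurable C ?_
  refine (withDensity_absolutelyContinuous _ _).ae_le ?_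
  filter_upwards [ae_restrict_mem measurableSet_ball] with z hz
  exact hC z (Metric.ball_subset_closedBall hz)

/-- The disc polynomial `R^γ_{m,k}` as an element of the weighted `L²` space, for `γ > -1`. -/
noncomputable def discPolyL2 {γ : ℝ} (hγ : -1 < γ) (m k : ℕ) : WeightedL2 γ :=
  (memLp_discPoly hγ m k).toLp (discPoly γ m k)

end PolyBergman

namespace PolyBergman

/-! A polyanalytic `f` of order `n + 1` is `∑ z̄^k h_k` with `k ≤ n` and `h_k` holomorphic, hence a
series in the monomials `z^a z̄^k`. The measure is rotation invariant, so monomials of different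
degree `a - k` are orthogonal. Grouping by degree gives components, each a sum of at most `n + 1`
monomials, and each component is the orthogonal projection of `f` on its monomials, so its norm is
at most that of `f` (`inner_componentL2`, `norm_componentL2_le`).

On an annulus `r < |z| < 1` a component is a power of `z` times a polynomial in `|z|²` of degree at
most `n`. Linear independence of the `n + 1` radial powers bounds its coefficients, uniformly in the
degree up to a power of `r` (`exists_norm_coeff_le`).

Closedness follows: coefficients of a convergent sequence converge, with geometric majorants on the
disc. For density, triangularity shows that the disc polynomials span all `z^p z̄^q` with `q ≤ n`;
an element orthogonal to these has zero components, hence zero coefficients. -/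

/-! ### Decomposition into powers of `z̄` with holomorphic coefficients -/

theorem hasFDerivAt_conj (z : ℂ) :
    HasFDerivAt (fun w : ℂ => conj w) (Complex.conjCLE : ℂ →L[ℝ] ℂ) z :=
  Complex.conjCLE.toContinuousLinearMap.hasFDerivAt

/-- Holomorphic functions are killed by `∂/∂z̄`, and `∂/∂z̄` differentiates powers of `z̄`. -/
theorem dbar_conj_pow_mul (k : ℕ) {h : ℂ → ℂ} {z : ℂ} (hh : DifferentiableAt ℂ h z) :
    dbar (fun w => conj w ^ k * h w) z = k * conj z ^ (k - 1) * h z := by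
  have e := (hh.hasDerivAt.hasFDerivAt.restrictScalars ℝ)
  have h2 : HasFDerivAt (fun w => conj w ^ k * h w) _ z := ((hasFDerivAt_conj z).pow k).mul e
  rw [dbar, h2.fderiv]
  simp
  linear_combination (-(1/2) * (k * conj z ^ (k-1) * h z) + (1/2) * (conj z ^k * deriv h z)) * Complex.I_sq

theorem contDiffOn_conj_pow_mul (N : ℕ) (k : ℕ) {h : ℂ → ℂ} (hh : DifferentiableOn ℂ h disc) :
    ContDiffOn ℝ (N : ℕ∞ω) (fun w => conj w ^ k * h w) disc := by
  have h1 : ContDiffOn ℝ (N : ℕ∞ω) h disc :=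
    (hh.contDiffOn Metric.isOpen_ball).restrict_scalars ℝ
  have h2 : ContDiff ℝ (N : ℕ∞ω) (fun w : ℂ => conj w) := Complex.conjCLE.contDiff
  exact (h2.pow k).contDiffOn.mul h1

theorem isPolyanalytic_conj_pow_mul {k N : ℕ} (hk : k < N) {h : ℂ → ℂ}
    (hh : DifferentiableOn ℂ h disc) : IsPolyanalytic N (fun w => conj w ^ k * h w) := by
  refine ⟨contDiffOn_conj_pow_mul N k hh, ?_⟩
  induction k generalizing N h with
  | zero =>
    obtain ⟨N, rfl⟩ : ∃ M, N = M + 1 := ⟨N - 1, by omega⟩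
    intro z hz
    rw [Function.iterate_succ_apply]
    have : EqOn (dbar (fun w => conj w ^ 0 * h w)) 0 disc := fun w hw => by
      rw [dbar_conj_pow_mul 0 (hh.differentiableAt (Metric.isOpen_ball.mem_nhds hw))]
      simp
    rw [dbar_iterate_congr N this hz]
    exact (isPolyanalytic_zero N).2 z hz
  | succ k ih =>
    obtain ⟨N, rfl⟩ : ∃ M, N = M + 1 := ⟨N - 1, by omega⟩
    intro z hz
    rw [Function.iterate_succ_apply]
    have : EqOn (dbar (fun w => conj w ^ (k + 1) * h w))
        (fun w => conj w ^ k * (((k + 1 : ℕ) : ℂ) • h) w) disc := fun w hw => by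
      rw [dbar_conj_pow_mul (k + 1) (hh.differentiableAt (Metric.isOpen_ball.mem_nhds hw))]
      simp
      ring
    rw [dbar_iterate_congr N this hz]
    exact ih (by omega) (hh.const_smul _) z hz

theorem IsPolyanalytic.sum {ι : Type*} {N : ℕ} (s : Finset ι) {f : ι → ℂ → ℂ}
    (hf : ∀ i ∈ s, IsPolyanalytic N (f i)) : IsPolyanalytic N (∑ i ∈ s, f i) := by
  classical
  induction s using Finset.induction_on with
  | empty => simpa using isPolyanalytic_zero N
  | insert a s ha ih =>
    rw [Finset.sum_insert ha]
    exact (hf a (by simp)).add (ih fun i hi => hf i (by simp [hi]))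

theorem IsPolyanalytic.congr {N : ℕ} {f g : ℂ → ℂ} (hf : IsPolyanalytic N f)
    (h : EqOn g f disc) : IsPolyanalytic N g :=
  ⟨hf.1.congr h, fun z hz => by rw [dbar_iterate_congr N h hz, hf.2 z hz]⟩

/-- A real-`C¹` solution of the Cauchy–Riemann equation `∂f/∂z̄ = 0` is holomorphic. -/
theorem differentiableOn_of_dbar_eq_zero {f : ℂ → ℂ} (hf : ∀ z ∈ disc, DifferentiableAt ℝ f z)
    (h : ∀ z ∈ disc, dbar f z = 0) : DifferentiableOn ℂ f disc := by
  intro z hz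
  refine (differentiableAt_complex_iff_differentiableAt_real.2
    ⟨hf z hz, ?_⟩).differentiableWithinAt
  have := h z hz
  simp only [dbar] at this
  simp only [smul_eq_mul]
  linear_combination (-2 * Complex.I) * this + fderiv ℝ f z Complex.I * Complex.I_sq

/-- Induction on the order: decompose `dbar f`, integrate in `z̄` term by term, and note that `f`
differs from this primitive by a holomorphic function. -/
theorem IsPolyanalytic.exists_holomorphic {N : ℕ} {f : ℂ → ℂ} (hf : IsPolyanalytic N f) :
    ∃ h : ℕ → ℂ → ℂ, (∀ k, DifferentiableOn ℂ (h k) disc) ∧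
      ∀ z ∈ disc, f z = ∑ k ∈ Finset.range N, conj z ^ k * h k z := by
  induction N generalizing f with
  | zero => exact ⟨0, fun k => differentiableOn_const 0, fun z hz => by simpa using hf.2 z hz⟩
  | succ N ih =>
    obtain ⟨h, hh, hfh⟩ := ih (f := dbar f) ⟨contDiffOn_dbar hf.1, fun z hz => by
      have := hf.2 z hz
      rwa [Function.iterate_succ_apply] at this⟩
    -- A `z̄`-primitive of `z̄^k h_k` is `z̄^(k+1) h_k / (k+1)`.
    let H : ℕ → ℂ → ℂ := fun k => (((k + 1 : ℕ) : ℂ)⁻¹) • h k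
    have hH : ∀ k, DifferentiableOn ℂ (H k) disc := fun k => (hh k).const_smul _
    let p : ℂ → ℂ := ∑ k ∈ Finset.range N, fun w => conj w ^ (k + 1) * H k w
    have hd : ∀ k, ∀ z ∈ disc, DifferentiableAt ℝ (fun w => conj w ^ (k + 1) * H k w) z :=
      fun k z hz => differentiableAt_of_contDiffOn (N := 0)
        (contDiffOn_conj_pow_mul 1 (k + 1) (hH k)) hz
    have hp : ∀ z ∈ disc, DifferentiableAt ℝ p z := fun z hz =>
      DifferentiableAt.sum fun k _ => hd k z hz
    have hdp : ∀ z ∈ disc, dbar p z = dbar f z := by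
      intro z hz
      have e : dbar p z = ∑ k ∈ Finset.range N, dbar (fun w => conj w ^ (k + 1) * H k w) z := by
        simp only [dbar, p]
        rw [fderiv_sum fun k _ => hd k z hz]
        simp only [FunLike.coe_sum, Finset.sum_apply]
        rw [Finset.mul_sum, ← Finset.sum_add_distrib, Finset.mul_sum]
      rw [e, hfh z hz]
      refine Finset.sum_congr rfl fun k _ => ?_
      rw [dbar_conj_pow_mul (k + 1) ((hH k).differentiableAt (Metric.isOpen_ball.mem_nhds hz))]
      have : ((k + 1 : ℕ) : ℂ) ≠ 0 := by exact_mod_cast k.succ_ne_zero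
      simp only [H, Pi.smul_apply, smul_eq_mul, Nat.add_sub_cancel]
      field_simp
    have hfd : ∀ z ∈ disc, DifferentiableAt ℝ f z := fun z hz =>
      differentiableAt_of_contDiffOn hf.1 hz
    have hg : DifferentiableOn ℂ (f - p) disc := by
      refine differentiableOn_of_dbar_eq_zero (fun z hz => (hfd z hz).sub (hp z hz)) ?_
      intro z hz
      have := hdp z hz
      simp only [dbar] at this ⊢
      rw [fderiv_sub (hfd z hz) (hp z hz)]
      simp only [_root_.sub_apply]
      linear_combination -this
    refine ⟨fun k => Nat.casesOn k (f - p) H, fun k => ?_, fun z hz => ?_⟩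
    · cases k with
      | zero => exact hg
      | succ k => exact hH k
    · rw [Finset.sum_range_succ']
      simp [p, Finset.sum_apply]

/-! ### Power series expansions -/

/-- `f` is given on the disc by the expansion `∑_{k ≤ n} z̄^k ∑_a c k a z^a`. -/
def HasExpansion (n : ℕ) (c : ℕ → ℕ → ℂ) (f : ℂ → ℂ) : Prop :=
  (∀ k, ∀ z ∈ disc, Summable fun a => c k a * z ^ a) ∧
    ∀ z ∈ disc, f z = ∑ k ∈ Finset.range (n + 1), conj z ^ k * ∑' a, c k a * z ^ a

theorem IsPolyanalytic.exists_hasExpansion {n : ℕ} {f : ℂ → ℂ} (hf : IsPolyanalytic (n + 1) f) :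
    ∃ c, HasExpansion n c f := by
  obtain ⟨h, hh, hfh⟩ := hf.exists_holomorphic
  have key : ∀ k, ∀ z ∈ disc, HasSum
      (fun a => (((a.factorial : ℂ)⁻¹) * iteratedDeriv a (h k) 0) * z ^ a) (h k z) := by
    intro k z hz
    have := Complex.hasSum_taylorSeries_on_ball (c := 0) (r := 1) (f := h k) (z := z)
      (by simpa using hh k) (by simpa using hz)
    refine this.congr_fun fun a => ?_
    simp only [smul_eq_mul, sub_zero]
    ring
  refine ⟨fun k a => ((a.factorial : ℂ)⁻¹) * iteratedDeriv a (h k) 0,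
    fun k z hz => (key k z hz).summable, fun z hz => ?_⟩
  rw [hfh z hz]
  exact Finset.sum_congr rfl fun k _ => by rw [(key k z hz).tsum_eq]

theorem differentiableOn_tsum_mul_pow {c : ℕ → ℂ}
    (hc : ∀ z ∈ disc, Summable fun a => c a * z ^ a) :
    DifferentiableOn ℂ (fun z => ∑' a, c a * z ^ a) disc := by
  have hloc : ∀ r : ℝ, 0 < r → r < 1 →
      DifferentiableOn ℂ (fun z => ∑' a, c a * z ^ a) (Metric.ball 0 r) := by
    intro r hr0 hr1
    -- Convergence at the point `r` of the disc is absolute, which feeds the Weierstrass test on the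
    -- ball of radius `r`.
    have hs : Summable fun a => ‖c a * (r : ℂ) ^ a‖ :=
      (hc r (by simpa [abs_of_pos hr0] using hr1)).norm
    refine Complex.differentiableOn_tsum_of_summable_norm hs
      (fun a => by fun_prop) Metric.isOpen_ball fun a z hz => ?_
    simp only [norm_mul, norm_pow, Complex.norm_real, Real.norm_eq_abs, abs_of_pos hr0]
    have : ‖z‖ ≤ r := by simpa using (Metric.mem_ball.1 hz).le
    gcongr
  intro z hz
  have hz1 : ‖z‖ < 1 := by simpa using hz
  obtain ⟨r, hzr, hr1⟩ := exists_between hz1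
  exact ((hloc r ((norm_nonneg z).trans_lt hzr) hr1).differentiableAt
    (Metric.isOpen_ball.mem_nhds (by simpa using hzr))).differentiableWithinAt

theorem HasExpansion.isPolyanalytic {n : ℕ} {c : ℕ → ℕ → ℂ} {f : ℂ → ℂ}
    (hf : HasExpansion n c f) : IsPolyanalytic (n + 1) f := by
  refine (IsPolyanalytic.sum (Finset.range (n + 1))
    (f := fun k z => conj z ^ k * ∑' a, c k a * z ^ a) fun k hk =>
    isPolyanalytic_conj_pow_mul (Finset.mem_range.1 hk)
      (differentiableOn_tsum_mul_pow (hf.1 k))).congr fun z hz => ?_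
  rw [hf.2 z hz, Finset.sum_apply]

/-! ### Rotation invariance and orthogonality -/

theorem measurePreserving_rotation (γ : ℝ) (u : Circle) :
    MeasurePreserving (rotation u) (diskMeasure γ) (diskMeasure γ) := by
  refine ⟨(rotation u).continuous.measurable, ?_⟩
  ext s hs
  have hm := (rotation u).continuous.measurable
  rw [Measure.map_apply hm hs, diskMeasure, withDensity_apply _ (hm hs), withDensity_apply _ hs,
    Measure.restrict_restrict hs, Measure.restrict_restrict (hm hs)]
  have h1 : rotation u ⁻¹' s ∩ disc = rotation u ⁻¹' (s ∩ disc) := by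
    ext z
    simp only [mem_preimage, mem_inter_iff, mem_ball_zero_iff, LinearIsometryEquiv.norm_map]
  have h2 := (rotation u).measurePreserving.setLIntegral_comp_preimage_emb
    (rotation u).toHomeomorph.measurableEmbedding
    (fun z => ENNReal.ofReal ((1 - ‖z‖ ^ 2) ^ γ)) (s ∩ disc)
  rw [h1, ← h2]
  simp only [LinearIsometryEquiv.norm_map]

/-- By rotation invariance, monomials in `z` and `z̄` of different degrees are orthogonal. -/
theorem setIntegral_pow_mul_conj_pow_eq_zero (γ R : ℝ) {a b : ℕ} (hab : a ≠ b) :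
    ∫ z in Metric.ball (0 : ℂ) R, z ^ a * conj z ^ b ∂diskMeasure γ = 0 := by
  have hne : (a : ℂ) - b ≠ 0 := sub_ne_zero.2 (by exact_mod_cast hab)
  -- Chosen so that `u^(a-b) = -1`: the rotation flips the sign of the integrand.
  let u : Circle := Circle.exp (Real.pi / ((a : ℝ) - b))
  have hu : (u : ℂ) ^ a * conj (u : ℂ) ^ b = -1 := by
    rw [Circle.coe_exp, ← Complex.exp_conj, ← Complex.exp_nat_mul, ← Complex.exp_nat_mul,
      ← Complex.exp_add, ← Complex.exp_pi_mul_I]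
    congr 1
    simp only [map_mul, Complex.conj_ofReal, Complex.conj_I]
    push_cast
    field_simp
    ring
  have h := (measurePreserving_rotation γ u).setIntegral_preimage_emb
    (rotation u).toHomeomorph.measurableEmbedding (fun z => z ^ a * conj z ^ b)
    (Metric.ball (0 : ℂ) R)
  have h1 : rotation u ⁻¹' (Metric.ball (0 : ℂ) R) = Metric.ball (0 : ℂ) R := by
    ext z
    simp only [mem_preimage, mem_ball_zero_iff, LinearIsometryEquiv.norm_map]
  have h2 : ∀ z : ℂ, rotation u z ^ a * conj (rotation u z) ^ b = -(z ^ a * conj z ^ b) := by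
    intro z
    rw [rotation_apply, map_mul, mul_pow, mul_pow]
    linear_combination (z ^ a * conj z ^ b) * hu
  simp only [h1, h2, integral_neg] at h
  linear_combination (-1/2 : ℂ) * h

theorem ae_mem_disc (γ : ℝ) : ∀ᵐ z ∂diskMeasure γ, z ∈ disc :=
  (withDensity_absolutelyContinuous _ _).ae_le (ae_restrict_mem measurableSet_ball)

theorem memLp_of_continuous {γ : ℝ} (hγ : -1 < γ) {φ : ℂ → ℂ} (hφ : Continuous φ) (p : ℝ≥0∞) :
    MemLp φ p (diskMeasure γ) := by
  have := isFiniteMeasure_diskMeasure hγ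
  obtain ⟨C, hC⟩ := (isCompact_closedBall (0 : ℂ) 1).exists_bound_of_continuousOn hφ.continuousOn
  refine MemLp.of_bound hφ.aestronglyMeasurable C ?_
  filter_upwards [ae_mem_disc γ] with z hz
  exact hC z (Metric.ball_subset_closedBall hz)

/-- Since `R < 1`, the series converges absolutely at `R`, and its terms there dominate those on the
ball; the measure being finite, sum and integral commute. -/
theorem setIntegral_tsum_mul {γ : ℝ} (hγ : -1 < γ) {c : ℕ → ℂ}
    (hc : ∀ z ∈ disc, Summable fun a => c a * z ^ a) {R : ℝ} (hR0 : 0 < R) (hR : R < 1)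
    (q s : ℕ) :
    ∫ z in Metric.ball (0 : ℂ) R, (∑' a, c a * z ^ a) * (z ^ q * conj z ^ s) ∂diskMeasure γ =
      ∑' a, c a * ∫ z in Metric.ball (0 : ℂ) R, z ^ (a + q) * conj z ^ s ∂diskMeasure γ := by
  have := isFiniteMeasure_diskMeasure hγ
  have hs : Summable fun a => ‖c a * (R : ℂ) ^ a‖ :=
    (hc R (by simpa [abs_of_pos hR0] using hR)).norm
  have hint : ∀ a, Integrable (fun z : ℂ => c a * (z ^ (a + q) * conj z ^ s))
      ((diskMeasure γ).restrict (Metric.ball (0 : ℂ) R)) := fun a =>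
    ((memLp_of_continuous hγ (by fun_prop) 1).integrable le_rfl).restrict
  have hb : ∀ a, ∀ z ∈ Metric.ball (0 : ℂ) R,
      ‖c a * (z ^ (a + q) * conj z ^ s)‖ ≤ ‖c a * (R : ℂ) ^ a‖ := by
    intro a z hz
    have hz' : ‖z‖ ≤ R := by simpa using (Metric.mem_ball.1 hz).le
    have hz1 : ‖z‖ ≤ 1 := hz'.trans hR.le
    simp only [norm_mul, norm_pow, RCLike.norm_conj, Complex.norm_real, Real.norm_eq_abs,
      abs_of_pos hR0, pow_add]
    have h1 : ‖z‖ ^ a ≤ R ^ a := by gcongr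
    have h2 : ‖z‖ ^ q ≤ 1 := pow_le_one₀ (norm_nonneg _) hz1
    have h3 : ‖z‖ ^ s ≤ 1 := pow_le_one₀ (norm_nonneg _) hz1
    have h4 : ‖z‖ ^ a * ‖z‖ ^ q * ‖z‖ ^ s ≤ R ^ a * 1 * 1 := by gcongr
    have := mul_le_mul_of_nonneg_left h4 (norm_nonneg (c a))
    simpa using this
  have hsum : Summable fun a => ∫ z in Metric.ball (0 : ℂ) R,
      ‖c a * (z ^ (a + q) * conj z ^ s)‖ ∂diskMeasure γ := by
    refine Summable.of_nonneg_of_le (fun a => integral_nonneg fun z => norm_nonneg _) (fun a => ?_)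
      (hs.mul_right ((diskMeasure γ).real (Metric.ball (0 : ℂ) R)))
    have := setIntegral_mono_on (hint a).norm
      (integrableOn_const (C := ‖c a * (R : ℂ) ^ a‖) (measure_ne_top _ _))
      measurableSet_ball (hb a)
    rw [setIntegral_const, smul_eq_mul, mul_comm] at this
    exact this
  have h := hasSum_integral_of_summable_integral_norm hint hsum
  rw [show (fun a => c a * ∫ z in Metric.ball (0 : ℂ) R, z ^ (a + q) * conj z ^ s ∂diskMeasure γ)
    = fun a => ∫ z in Metric.ball (0 : ℂ) R, c a * (z ^ (a + q) * conj z ^ s) ∂diskMeasure γ from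
    funext fun a => (integral_const_mul _ _).symm, h.tsum_eq]
  refine integral_congr_ae (Filter.Eventually.of_forall fun z => ?_)
  simp only [← tsum_mul_right]
  refine tsum_congr fun a => ?_
  ring

/-! ### Homogeneous components -/

/-- The coefficient of `z^(e + k - n) z̄^k`, which is homogeneous of degree `e - n` under
rotations, in the expansion with coefficients `c`. -/
def shiftCoeff (n : ℕ) (c : ℕ → ℕ → ℂ) (e k : ℕ) : ℂ :=
  if n ≤ e + k then c k (e + k - n) else 0

/-- The part of an expansion that is homogeneous of degree `e - n` under rotations. -/
def component (n : ℕ) (c : ℕ → ℕ → ℂ) (e : ℕ) (z : ℂ) : ℂ :=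
  ∑ k ∈ Finset.range (n + 1), shiftCoeff n c e k * (z ^ (e + k - n) * conj z ^ k)

theorem continuous_component (n : ℕ) (c : ℕ → ℕ → ℂ) (e : ℕ) : Continuous (component n c e) := by
  unfold component
  fun_prop

/-- The condition `he` says that `z^p z̄^q` has degree `e - n`; orthogonality kills every term of
another degree. -/
theorem setIntegral_mul_conj_monomial {γ : ℝ} (hγ : -1 < γ) {n : ℕ} {c : ℕ → ℕ → ℂ} {f : ℂ → ℂ}
    (hf : HasExpansion n c f) {R : ℝ} (hR0 : 0 < R) (hR : R < 1) {e p q : ℕ}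
    (he : e + q = p + n) :
    ∫ z in Metric.ball (0 : ℂ) R, f z * conj (z ^ p * conj z ^ q) ∂diskMeasure γ =
      ∫ z in Metric.ball (0 : ℂ) R, component n c e z * conj (z ^ p * conj z ^ q)
        ∂diskMeasure γ := by
  have := isFiniteMeasure_diskMeasure hγ
  have e1 : ∀ z ∈ Metric.ball (0 : ℂ) R, f z * conj (z ^ p * conj z ^ q) =
      ∑ k ∈ Finset.range (n + 1), (∑' a, c k a * z ^ a) * (z ^ q * conj z ^ (k + p)) := by
    intro z hz
    rw [hf.2 z (Metric.ball_subset_ball hR.le hz), Finset.sum_mul]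
    refine Finset.sum_congr rfl fun k _ => ?_
    simp only [map_mul, map_pow, Complex.conj_conj]
    ring
  have e2 : ∀ z : ℂ, component n c e z * conj (z ^ p * conj z ^ q) =
      ∑ k ∈ Finset.range (n + 1),
        shiftCoeff n c e k * (z ^ (e + k - n + q) * conj z ^ (k + p)) := by
    intro z
    rw [component, Finset.sum_mul]
    refine Finset.sum_congr rfl fun k _ => ?_
    simp only [map_mul, map_pow, Complex.conj_conj]
    ring
  rw [setIntegral_congr_fun measurableSet_ball e1, integral_congr_ae (.of_forall e2),
    integral_finsetSum, integral_finsetSum]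
  · refine Finset.sum_congr rfl fun k _ => ?_
    rw [setIntegral_tsum_mul hγ (hf.1 k) hR0 hR, integral_const_mul, shiftCoeff]
    split_ifs with h
    · refine tsum_eq_single (e + k - n) fun a ha => ?_
      rw [setIntegral_pow_mul_conj_pow_eq_zero γ R (by omega), mul_zero]
    -- Here `e + k < n`, so no exponent `a ≥ 0` gives degree `e - n` and all terms vanish.
    · rw [zero_mul]
      convert tsum_zero with a
      rw [setIntegral_pow_mul_conj_pow_eq_zero γ R (by omega), mul_zero]
  · intro k _
    exact ((memLp_of_continuous hγ (by fun_prop) 1).integrable le_rfl).restrict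
  · intro k _
    have hc : ContinuousOn (fun z => (∑' a, c k a * z ^ a) * (z ^ q * conj z ^ (k + p)))
        (Metric.closedBall (0 : ℂ) R) :=
      ((differentiableOn_tsum_mul_pow (hf.1 k)).continuousOn.mono
        (Metric.closedBall_subset_ball hR)).mul (by fun_prop)
    exact (hc.integrableOn_compact (isCompact_closedBall _ _)).mono_set
      Metric.ball_subset_closedBall

theorem tendsto_setIntegral_ball {γ : ℝ} {g : ℂ → ℂ} (hg : Integrable g (diskMeasure γ)) :
    Filter.Tendsto (fun j : ℕ => ∫ z in Metric.ball (0 : ℂ) (1 - 1 / ((j : ℝ) + 2)), g z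
      ∂diskMeasure γ) Filter.atTop (nhds (∫ z, g z ∂diskMeasure γ)) := by
  have hU : ⋃ j : ℕ, Metric.ball (0 : ℂ) (1 - 1 / ((j : ℝ) + 2)) = disc := by
    ext z
    simp only [mem_iUnion, mem_ball_zero_iff]
    constructor
    · rintro ⟨j, hj⟩
      have : 0 < 1 / ((j : ℝ) + 2) := by positivity
      linarith
    · intro hz
      obtain ⟨j, hj⟩ := exists_nat_one_div_lt (sub_pos.2 hz)
      refine ⟨j, ?_⟩
      have : 1 / ((j : ℝ) + 2) ≤ 1 / ((j : ℝ) + 1) := by gcongr; norm_num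
      linarith
  have h := tendsto_setIntegral_of_monotone (μ := diskMeasure γ) (f := g)
    (s := fun j : ℕ => Metric.ball (0 : ℂ) (1 - 1 / ((j : ℝ) + 2)))
    (fun j => measurableSet_ball) (fun i j hij => Metric.ball_subset_ball (by gcongr))
    hg.integrableOn
  rwa [hU, Measure.restrict_eq_self_of_ae_mem (ae_mem_disc γ)] at h

/-- The power series may fail to converge uniformly up to the circle, so the identity is proved on
smaller balls and passed to the limit by integrability. -/
theorem integral_mul_conj_monomial {γ : ℝ} (hγ : -1 < γ) {n : ℕ} {c : ℕ → ℕ → ℂ} {f : ℂ → ℂ}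
    (hf : HasExpansion n c f) (hf2 : MemLp f 2 (diskMeasure γ)) {e p q : ℕ}
    (he : e + q = p + n) :
    ∫ z, f z * conj (z ^ p * conj z ^ q) ∂diskMeasure γ =
      ∫ z, component n c e z * conj (z ^ p * conj z ^ q) ∂diskMeasure γ := by
  have h1 : MemLp (fun z : ℂ => conj (z ^ p * conj z ^ q)) 2 (diskMeasure γ) :=
    memLp_of_continuous hγ (by fun_prop) 2
  have h2 := tendsto_setIntegral_ball (hf2.integrable_mul h1)
  have h3 := tendsto_setIntegral_ball
    ((memLp_of_continuous hγ (continuous_component n c e) 2).integrable_mul h1)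
  refine tendsto_nhds_unique h2 (h3.congr fun j => ?_)
  have hj : 1 / ((j : ℝ) + 2) ≤ 1 / 2 := by gcongr; linarith [j.cast_nonneg (α := ℝ)]
  have hj0 : 0 < 1 / ((j : ℝ) + 2) := by positivity
  exact (setIntegral_mul_conj_monomial hγ hf (by linarith) (by linarith) he).symm

/-- The class in the weighted `L²` space of a homogeneous component. -/
noncomputable def componentL2 {γ : ℝ} (hγ : -1 < γ) (n : ℕ) (c : ℕ → ℕ → ℂ) (e : ℕ) :
    WeightedL2 γ :=
  (memLp_of_continuous hγ (continuous_component n c e) 2).toLp _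

/-- The class of `z^p z̄^q` in the weighted `L²` space. -/
noncomputable def monomialL2 {γ : ℝ} (hγ : -1 < γ) (p q : ℕ) : WeightedL2 γ :=
  (memLp_of_continuous hγ (φ := fun z => z ^ p * conj z ^ q) (by fun_prop) 2).toLp _

theorem inner_monomialL2 {γ : ℝ} (hγ : -1 < γ) {n : ℕ} {c : ℕ → ℕ → ℂ} {f : ℂ → ℂ}
    (hf : HasExpansion n c f) {F : WeightedL2 γ} (hF : F =ᵐ[diskMeasure γ] f) {e p q : ℕ}
    (he : e + q = p + n) :
    inner ℂ (monomialL2 hγ p q) F = inner ℂ (monomialL2 hγ p q) (componentL2 hγ n c e) := by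
  have hf2 : MemLp f 2 (diskMeasure γ) := (memLp_congr_ae hF).1 (Lp.memLp F)
  rw [L2.inner_def, L2.inner_def]
  have h1 := (memLp_of_continuous hγ (φ := fun z => z ^ p * conj z ^ q) (by fun_prop) 2).coeFn_toLp
  have h2 := (memLp_of_continuous hγ (continuous_component n c e) 2).coeFn_toLp
  have h := integral_mul_conj_monomial hγ hf hf2 he
  convert h using 1
  · refine integral_congr_ae ?_
    filter_upwards [h1, hF] with z hz1 hz2
    rw [monomialL2, hz1, hz2, RCLike.inner_apply]
  · refine integral_congr_ae ?_
    filter_upwards [h1, h2] with z hz1 hz2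
    rw [monomialL2, hz1, componentL2, hz2, RCLike.inner_apply]

theorem coeFn_sum_monomialL2 {γ : ℝ} (hγ : -1 < γ) (s : Finset ℕ) (b : ℕ → ℂ) (p q : ℕ → ℕ) :
    ⇑(∑ k ∈ s, b k • monomialL2 hγ (p k) (q k)) =ᵐ[diskMeasure γ]
      fun z => ∑ k ∈ s, b k * (z ^ p k * conj z ^ q k) := by
  have h1 : ∀ k ∈ s, ⇑(b k • monomialL2 hγ (p k) (q k)) =ᵐ[diskMeasure γ]
      fun z => b k * (z ^ p k * conj z ^ q k) := by
    intro k _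
    filter_upwards [Lp.coeFn_smul (b k) (monomialL2 hγ (p k) (q k)),
      (memLp_of_continuous hγ (φ := fun z => z ^ p k * conj z ^ q k)
        (by fun_prop) 2).coeFn_toLp] with z h1 h2
    rw [h1, Pi.smul_apply, monomialL2, h2, smul_eq_mul]
  filter_upwards [Lp.coeFn_finsetSum s (fun k => b k • monomialL2 hγ (p k) (q k)),
    (ae_ball_iff s.countable_toSet).2 h1] with z hz1 hz2
  rw [hz1, Finset.sum_apply]
  exact Finset.sum_congr rfl fun k hk => hz2 k hk

theorem componentL2_eq_sum {γ : ℝ} (hγ : -1 < γ) (n : ℕ) (c : ℕ → ℕ → ℂ) (e : ℕ) :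
    componentL2 hγ n c e =
      ∑ k ∈ Finset.range (n + 1), shiftCoeff n c e k • monomialL2 hγ (e + k - n) k :=
  Lp.ext ((memLp_of_continuous hγ (continuous_component n c e) 2).coeFn_toLp.trans
    (coeFn_sum_monomialL2 hγ _ _ (fun k => e + k - n) fun k => k).symm)

/-- The component is itself a combination of monomials of degree `e - n`, against which it and `F`
have the same inner products. -/
theorem inner_componentL2 {γ : ℝ} (hγ : -1 < γ) {n : ℕ} {c : ℕ → ℕ → ℂ} {f : ℂ → ℂ}
    (hf : HasExpansion n c f) {F : WeightedL2 γ} (hF : F =ᵐ[diskMeasure γ] f) (e : ℕ) :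
    inner ℂ (componentL2 hγ n c e) F =
      inner ℂ (componentL2 hγ n c e) (componentL2 hγ n c e) := by
  conv_lhs => rw [componentL2_eq_sum]
  conv_rhs => arg 2; rw [componentL2_eq_sum]
  rw [sum_inner, sum_inner]
  refine Finset.sum_congr rfl fun k _ => ?_
  rw [inner_smul_left, inner_smul_left, shiftCoeff]
  split_ifs with h
  · rw [inner_monomialL2 hγ hf hF (e := e) (by omega)]
  · simp

theorem norm_componentL2_le {γ : ℝ} (hγ : -1 < γ) {n : ℕ} {c : ℕ → ℕ → ℂ} {f : ℂ → ℂ}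
    (hf : HasExpansion n c f) {F : WeightedL2 γ} (hF : F =ᵐ[diskMeasure γ] f) (e : ℕ) :
    ‖componentL2 hγ n c e‖ ≤ ‖F‖ := by
  have h := norm_inner_le_norm (𝕜 := ℂ) (componentL2 hγ n c e) F
  rw [inner_componentL2 hγ hf hF, inner_self_eq_norm_sq_to_K, norm_pow, RCLike.norm_ofReal,
    abs_norm, sq] at h
  rcases (norm_nonneg (componentL2 hγ n c e)).eq_or_lt with h0 | h0
  · rw [← h0]
    exact norm_nonneg F
  · exact le_of_mul_le_mul_left h h0

/-! ### Coefficient bounds from radial powers on an annulus -/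

/-- The class of `|z|^(2k)` in the weighted `L²` space of the annulus `r < |z| < 1`. -/
noncomputable def radialPowL2 {γ : ℝ} (hγ : -1 < γ) (r : ℝ) (k : ℕ) :
    Lp ℂ 2 ((diskMeasure γ).restrict {z | r < ‖z‖}) :=
  ((memLp_of_continuous hγ (φ := fun z => (z * conj z) ^ k) (by fun_prop) 2).restrict _).toLp _

theorem coeFn_sum_radialPowL2 {γ : ℝ} (hγ : -1 < γ) (r : ℝ) {n : ℕ} (g : Fin (n + 1) → ℂ) :
    ⇑(∑ i, g i • radialPowL2 hγ r i) =ᵐ[(diskMeasure γ).restrict {z | r < ‖z‖}]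
      fun z => ∑ i, g i * (z * conj z) ^ (i : ℕ) := by
  have h1 : ∀ i : Fin (n + 1), ⇑(g i • radialPowL2 hγ r i)
      =ᵐ[(diskMeasure γ).restrict {z | r < ‖z‖}] fun z => g i * (z * conj z) ^ (i : ℕ) := by
    intro i
    filter_upwards [Lp.coeFn_smul (g i) (radialPowL2 hγ r i), ((memLp_of_continuous hγ
      (φ := fun z => (z * conj z) ^ (i : ℕ)) (by fun_prop) 2).restrict
        {z | r < ‖z‖}).coeFn_toLp] with z h1 h2
    rw [h1, Pi.smul_apply, radialPowL2, h2, smul_eq_mul]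
  filter_upwards [Lp.coeFn_finsetSum Finset.univ (fun i => g i • radialPowL2 hγ r i),
    ae_all_iff.2 h1] with z hz1 hz2
  rw [hz1, Finset.sum_apply]
  exact Finset.sum_congr rfl fun i _ => hz2 i

theorem measurableSet_norm_gt (r : ℝ) : MeasurableSet {z : ℂ | r < ‖z‖} :=
  (isOpen_lt continuous_const continuous_norm).measurableSet

theorem restrict_volume_absolutelyContinuous (γ r : ℝ) :
    volume.restrict ({z : ℂ | r < ‖z‖} ∩ disc) ≪
      (diskMeasure γ).restrict {z | r < ‖z‖} := by
  rw [diskMeasure, restrict_withDensity (measurableSet_norm_gt r),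
    Measure.restrict_restrict (measurableSet_norm_gt r)]
  refine withDensity_absolutelyContinuous' (by fun_prop) ?_
  filter_upwards [ae_restrict_mem ((measurableSet_norm_gt r).inter measurableSet_ball)] with z hz
  have hz1 : ‖z‖ < 1 := by simpa using hz.2
  have : 0 < (1 - ‖z‖ ^ 2) ^ γ := Real.rpow_pos_of_pos (by nlinarith [norm_nonneg z]) _
  simpa using this

/-- A relation holds a.e. for Lebesgue measure because the weight is positive, hence everywhere on
the open annulus by continuity; the resulting polynomial vanishes at every `t²` with `r < t < 1`. -/
theorem linearIndependent_radialPowL2 {γ : ℝ} (hγ : -1 < γ) {r : ℝ} (hr0 : 0 < r) (hr : r < 1)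
    (n : ℕ) : LinearIndependent ℂ fun i : Fin (n + 1) => radialPowL2 hγ r i := by
  rw [Fintype.linearIndependent_iff]
  intro g hg
  have h1 : (fun z => ∑ i, g i * (z * conj z) ^ (i : ℕ))
      =ᵐ[volume.restrict ({z : ℂ | r < ‖z‖} ∩ disc)] fun _ => 0 := by
    refine (restrict_volume_absolutelyContinuous γ r).ae_le ?_
    have h2 := coeFn_sum_radialPowL2 hγ r g
    rw [hg] at h2
    exact h2.symm.trans (Lp.coeFn_zero _ _ _)
  have h3 := Measure.eqOn_open_of_ae_eq h1
    ((isOpen_lt continuous_const continuous_norm).inter Metric.isOpen_ball)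
    (by fun_prop) (by fun_prop)
  let p : Polynomial ℂ := ∑ i : Fin (n + 1), Polynomial.C (g i) * Polynomial.X ^ (i : ℕ)
  have hp : p = 0 := by
    refine Polynomial.eq_zero_of_infinite_isRoot p ?_
    have hinj : InjOn (fun t : ℝ => (t : ℂ) * conj (t : ℂ)) (Ioo r 1) := by
      intro s hs t ht hst
      have h : ((s * s : ℝ) : ℂ) = ((t * t : ℝ) : ℂ) := by
        simpa using hst
      have h' := Complex.ofReal_injective h
      exact (mul_self_inj (hr0.trans hs.1).le (hr0.trans ht.1).le).1 h'
    refine ((Ioo_infinite hr).image hinj).mono ?_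
    rintro _ ⟨t, ht, rfl⟩
    have ht0 : 0 < t := hr0.trans ht.1
    have := h3 (x := (t : ℂ)) ⟨by simpa [abs_of_pos ht0] using ht.1,
      by simpa [abs_of_pos ht0] using ht.2⟩
    simpa [p, Polynomial.IsRoot, Polynomial.eval_finsetSum] using this
  intro i
  have := congrArg (fun q : Polynomial ℂ => q.coeff i) hp
  simpa [p, Polynomial.finsetSum_coeff, Polynomial.coeff_C_mul, Polynomial.coeff_X_pow,
    Fin.val_inj] using this

theorem norm_sum_radialPowL2_le {γ : ℝ} (hγ : -1 < γ) {r : ℝ} (hr0 : 0 < r) (n : ℕ)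
    (c : ℕ → ℕ → ℂ) (e : ℕ) :
    r ^ e * ‖∑ i : Fin (n + 1), shiftCoeff n c e i • radialPowL2 hγ r i‖ ≤
      ‖componentL2 hγ n c e‖ := by
  have hm := memLp_of_continuous hγ (continuous_component n c e) 2
  have h0 : r ^ e * ‖∑ i : Fin (n + 1), shiftCoeff n c e i • radialPowL2 hγ r i‖ =
      ‖((r : ℂ) ^ e) • ∑ i : Fin (n + 1), shiftCoeff n c e i • radialPowL2 hγ r i‖ := by
    rw [norm_smul, norm_pow, Complex.norm_real, Real.norm_eq_abs, abs_of_pos hr0]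
  rw [h0, componentL2, Lp.norm_toLp, Lp.norm_def]
  refine ENNReal.toReal_mono hm.eLpNorm_ne_top ?_
  refine (eLpNorm_mono_ae ?_).trans
    (eLpNorm_mono_measure (component n c e) (Measure.restrict_le_self (s := {z | r < ‖z‖})))
  filter_upwards [Lp.coeFn_smul ((r : ℂ) ^ e)
      (∑ i : Fin (n + 1), shiftCoeff n c e i • radialPowL2 hγ r i),
    coeFn_sum_radialPowL2 hγ r (fun i : Fin (n + 1) => shiftCoeff n c e i),
    ae_restrict_mem (measurableSet_norm_gt r), ae_restrict_of_ae (ae_mem_disc γ)]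
    with z h1 h2 h3 h4
  have hz1 : ‖z‖ ≤ 1 := by simpa using (Metric.mem_ball.1 h4).le
  have hz2 : r ≤ ‖z‖ := le_of_lt h3
  rw [h1, Pi.smul_apply, h2, smul_eq_mul, norm_mul, norm_pow, Complex.norm_real,
    Real.norm_eq_abs, abs_of_pos hr0]
  -- The factor `z^n` clears the possibly negative degree `e - n` and costs nothing, since `‖z‖ ≤
  -- 1`.
  have e1 : z ^ n * component n c e z =
      z ^ e * ∑ i : Fin (n + 1), shiftCoeff n c e i * (z * conj z) ^ (i : ℕ) := by
    rw [Fin.sum_univ_eq_sum_range (fun i => shiftCoeff n c e i * (z * conj z) ^ i) (n + 1),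
      component, Finset.mul_sum, Finset.mul_sum]
    refine Finset.sum_congr rfl fun k _ => ?_
    rw [shiftCoeff]
    split_ifs with h
    · have : z ^ n * z ^ (e + k - n) = z ^ e * z ^ k := by
        rw [← pow_add, ← pow_add]
        congr 1
        omega
      rw [mul_pow]
      linear_combination (c k (e + k - n) * conj z ^ k) * this
    · simp
  calc r ^ e * ‖∑ i : Fin (n + 1), shiftCoeff n c e i * (z * conj z) ^ (i : ℕ)‖
      ≤ ‖z‖ ^ e * ‖∑ i : Fin (n + 1), shiftCoeff n c e i * (z * conj z) ^ (i : ℕ)‖ := by gcongr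
    _ = ‖z‖ ^ n * ‖component n c e z‖ := by rw [← norm_pow, ← norm_mul, ← e1, norm_mul, norm_pow]
    _ ≤ 1 * ‖component n c e z‖ := by
        gcongr
        exact pow_le_one₀ (norm_nonneg _) hz1
    _ = ‖component n c e z‖ := one_mul _

theorem exists_norm_shiftCoeff_le {γ : ℝ} (hγ : -1 < γ) {r : ℝ} (hr0 : 0 < r) (hr : r < 1)
    (n : ℕ) : ∃ C : ℝ, 0 ≤ C ∧ ∀ (c : ℕ → ℕ → ℂ) (e k : ℕ), k ≤ n →
      r ^ e * ‖shiftCoeff n c e k‖ ≤ C * ‖componentL2 hγ n c e‖ := by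
  let T : (Fin (n + 1) → ℂ) →ₗ[ℂ] Lp ℂ 2 ((diskMeasure γ).restrict {z | r < ‖z‖}) :=
    Fintype.linearCombination ℂ fun i : Fin (n + 1) => radialPowL2 hγ r i
  have hT : T.ker = ⊥ := LinearMap.ker_eq_bot.2
    (linearIndependent_radialPowL2 hγ hr0 hr n).fintypeLinearCombination_injective
  -- An injective linear map from a finite-dimensional space is bounded below; `T` depends on
  -- neither `e` nor `c`, so neither does `K`.
  obtain ⟨K, -, hK⟩ := T.exists_antilipschitzWith hT
  refine ⟨K, K.2, fun c e k hk => ?_⟩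
  let q : Fin (n + 1) → ℂ := fun i => shiftCoeff n c e i
  have h1 : ‖q‖ ≤ K * ‖T q‖ := by
    simpa using hK.le_mul_dist q 0
  have h2 : ‖shiftCoeff n c e k‖ ≤ ‖q‖ := norm_le_pi_norm q ⟨k, Nat.lt_succ_of_le hk⟩
  have h3 : r ^ e * ‖T q‖ ≤ ‖componentL2 hγ n c e‖ := norm_sum_radialPowL2_le hγ hr0 n c e
  calc r ^ e * ‖shiftCoeff n c e k‖ ≤ r ^ e * (K * ‖T q‖) := by gcongr; exact h2.trans h1
    _ = K * (r ^ e * ‖T q‖) := by ring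
    _ ≤ K * ‖componentL2 hγ n c e‖ := by gcongr

theorem shiftCoeff_add_sub {n k : ℕ} (c : ℕ → ℕ → ℂ) (a : ℕ) (hk : k ≤ n) :
    shiftCoeff n c (a + n - k) k = c k a := by
  rw [shiftCoeff, if_pos (by omega)]
  congr 1
  omega

/-- The Taylor coefficients of the holomorphic parts of a polyanalytic function are controlled by
its weighted `L²` norm. -/
theorem exists_norm_coeff_le {γ : ℝ} (hγ : -1 < γ) {r : ℝ} (hr0 : 0 < r) (hr : r < 1)
    (n : ℕ) : ∃ C : ℝ, 0 ≤ C ∧ ∀ (c : ℕ → ℕ → ℂ) (f : ℂ → ℂ) (F : WeightedL2 γ),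
      HasExpansion n c f → F =ᵐ[diskMeasure γ] f → ∀ a k : ℕ, k ≤ n →
        ‖c k a‖ * r ^ a ≤ C * ‖F‖ := by
  obtain ⟨C, hC0, hC⟩ := exists_norm_shiftCoeff_le hγ hr0 hr n
  -- The coefficient `c k a` sits in the component of index `a + n - k ≤ a + n`, so at most a factor
  -- `r^n` is lost.
  refine ⟨C / r ^ n, by positivity, fun c f F hf hF a k hk => ?_⟩
  have h1 := hC c (a + n - k) k hk
  rw [shiftCoeff_add_sub c a hk] at h1
  have h2 : r ^ (a + n) ≤ r ^ (a + n - k) := pow_le_pow_of_le_one hr0.le hr.le (by omega)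
  have h3 : r ^ (a + n) * ‖c k a‖ ≤ C * ‖F‖ :=
    (mul_le_mul_of_nonneg_right h2 (norm_nonneg _)).trans
      (h1.trans (mul_le_mul_of_nonneg_left (norm_componentL2_le hγ hf hF _) hC0))
  rw [div_mul_eq_mul_div, le_div_iff₀ (by positivity)]
  rw [pow_add] at h3
  linarith

/-! ### Disc polynomials and monomials -/

/-- The nonzero top coefficient makes the passage from monomials to disc polynomials invertible; it
is a ratio of positive Pochhammer values. -/
theorem exists_jacobi_eq_sum {α β : ℝ} (hα : -1 < α) (hβ : 0 ≤ β) (k : ℕ) :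
    ∃ b : ℕ → ℝ, b k ≠ 0 ∧
      ∀ s : ℝ, jacobi α β k (2 * s - 1) = ∑ i ∈ Finset.range (k + 1), b i * s ^ i := by
  let a : ℕ → ℝ := fun j => (k.choose j : ℝ) * (ascPochhammer ℝ j).eval ((k : ℝ) + α + β + 1)
      / (ascPochhammer ℝ j).eval (α + 1)
  let p : Polynomial ℝ := ∑ j ∈ Finset.range (k + 1),
    Polynomial.C (a j) * (Polynomial.X - Polynomial.C 1) ^ j
  have hdeg : ∀ j, (Polynomial.C (a j) * (Polynomial.X - Polynomial.C 1) ^ j).natDegree ≤ j := by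
    intro j
    refine (Polynomial.natDegree_C_mul_le _ _).trans (Polynomial.natDegree_pow_le.trans ?_)
    rw [Polynomial.natDegree_X_sub_C, mul_one]
  have hp : p.natDegree < k + 1 := by
    refine Nat.lt_succ_of_le (Polynomial.natDegree_sum_le_of_forall_le _ _ fun j hj => ?_)
    exact (hdeg j).trans (Nat.lt_succ_iff.1 (Finset.mem_range.1 hj))
  refine ⟨p.coeff, ?_, fun s => ?_⟩
  · have h1 : p.coeff k = a k := by
      simp only [p, Polynomial.finsetSum_coeff]
      rw [Finset.sum_range_succ, Finset.sum_eq_zero, zero_add, Polynomial.coeff_C_mul]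
      · have h2 := (Polynomial.monic_X_sub_C (1 : ℝ)).pow k
        have h3 : ((Polynomial.X - Polynomial.C (1 : ℝ)) ^ k).natDegree = k := by
          rw [(Polynomial.monic_X_sub_C (1 : ℝ)).natDegree_pow, Polynomial.natDegree_X_sub_C,
            mul_one]
        have h4 := h2.coeff_natDegree
        rw [h3] at h4
        rw [h4, mul_one]
      · intro j hj
        exact Polynomial.coeff_eq_zero_of_natDegree_lt
          ((hdeg j).trans_lt (Finset.mem_range.1 hj))
    rw [h1]
    have h5 : 0 < (ascPochhammer ℝ k).eval (α + 1) := ascPochhammer_pos k _ (by linarith)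
    rcases k.eq_zero_or_pos with rfl | hk
    · simp [a]
    · have hk1 : (1 : ℝ) ≤ k := by exact_mod_cast hk
      have h6 : 0 < (ascPochhammer ℝ k).eval ((k : ℝ) + α + β + 1) :=
        ascPochhammer_pos k _ (by linarith)
      simp only [a, Nat.choose_self, Nat.cast_one, one_mul]
      exact (div_pos h6 h5).ne'
  · rw [← Polynomial.eval_eq_sum_range' hp]
    simp only [p, Polynomial.eval_finsetSum, jacobi, Polynomial.eval_mul, Polynomial.eval_C,
      Polynomial.eval_pow, Polynomial.eval_sub, Polynomial.eval_X]
    refine Finset.sum_congr rfl fun j _ => ?_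
    rw [show (2 * s - 1 - 1) / 2 = s - 1 by ring]

theorem exists_discPolyL2_eq_sum {γ : ℝ} (hγ : -1 < γ) (m k : ℕ) :
    ∃ b : ℕ → ℂ, b (min m k) ≠ 0 ∧ discPolyL2 hγ m k =
      ∑ i ∈ Finset.range (min m k + 1), b i • monomialL2 hγ (m - k + i) (k - m + i) := by
  obtain ⟨b, hb0, hb⟩ := exists_jacobi_eq_sum hγ (abs_nonneg ((m : ℝ) - (k : ℝ))) (min m k)
  refine ⟨fun i => b i, Complex.ofReal_ne_zero.2 hb0, Lp.ext ?_⟩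
  refine (memLp_discPoly hγ m k).coeFn_toLp.trans (Filter.EventuallyEq.trans ?_
    (coeFn_sum_monomialL2 hγ _ _ (fun i => m - k + i) fun i => k - m + i).symm)
  refine Filter.Eventually.of_forall fun z => ?_
  simp only [discPoly]
  rw [hb, Complex.ofReal_sum, Finset.mul_sum]
  refine Finset.sum_congr rfl fun i _ => ?_
  have : (z * conj z) = ((‖z‖ ^ 2 : ℝ) : ℂ) := by
    rw [Complex.mul_conj, Complex.normSq_eq_norm_sq]
  rw [Complex.ofReal_mul, Complex.ofReal_pow, ← this]
  ring

/-- The span of the disc polynomials `R^γ_{m,k}` with `k ≤ n`. -/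
noncomputable def discPolySpan {γ : ℝ} (hγ : -1 < γ) (n : ℕ) : Submodule ℂ (WeightedL2 γ) :=
  Submodule.span ℂ {F : WeightedL2 γ | ∃ m k : ℕ, k ≤ n ∧ F = discPolyL2 hγ m k}

/-- Triangularity: besides `z^p z̄^q`, the disc polynomial of index `(p, q)` contains only monomials
with both exponents lowered equally, so the exponent of `z̄` stays at most `n`. -/
theorem monomialL2_mem_discPolySpan {γ : ℝ} (hγ : -1 < γ) {n p q : ℕ} (hq : q ≤ n) :
    monomialL2 hγ p q ∈ discPolySpan hγ n := by
  induction hl : min p q using Nat.strong_induction_on generalizing p q with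
  | _ l ih =>
    obtain ⟨b, hb0, hb⟩ := exists_discPolyL2_eq_sum hγ p q
    rw [hl] at hb hb0
    rw [Finset.sum_range_succ, show p - q + l = p by omega, show q - p + l = q by omega] at hb
    have h1 : b l • monomialL2 hγ p q ∈ discPolySpan hγ n := by
      rw [← sub_eq_iff_eq_add'.2 hb]
      refine Submodule.sub_mem _ (Submodule.subset_span ⟨p, q, hq, rfl⟩)
        (Submodule.sum_mem _ fun i hi => Submodule.smul_mem _ _ ?_)
      have := Finset.mem_range.1 hi
      exact ih i this (by omega) (by omega)
    exact (Submodule.smul_mem_iff _ hb0).1 h1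

theorem monomialL2_mem_polyBergman {γ : ℝ} (hγ : -1 < γ) {n p q : ℕ} (hq : q ≤ n) :
    monomialL2 hγ p q ∈ polyBergman γ n :=
  ⟨fun z => z ^ p * conj z ^ q,
    (isPolyanalytic_conj_pow_mul (h := fun z => z ^ p) (Nat.lt_succ_of_le hq)
      (by fun_prop)).congr fun z _ => mul_comm _ _,
    (memLp_of_continuous hγ (by fun_prop) 2).coeFn_toLp⟩

theorem discPolySpan_le_polyBergman {γ : ℝ} (hγ : -1 < γ) (n : ℕ) :
    discPolySpan hγ n ≤ polyBergman γ n := by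
  refine Submodule.span_le.2 ?_
  rintro _ ⟨m, k, hk, rfl⟩
  obtain ⟨b, -, hb⟩ := exists_discPolyL2_eq_sum hγ m k
  rw [hb]
  refine Submodule.sum_mem _ fun i hi => Submodule.smul_mem _ _ ?_
  have := Finset.mem_range.1 hi
  exact monomialL2_mem_polyBergman hγ (by omega)

/-! ### Density and closedness -/

/-- Each component of `F` lies in the span, so its squared norm, equal to its inner product with
`F`, is zero; the coefficient bound then annihilates the expansion. -/
theorem eq_zero_of_mem_polyBergman_of_orthogonal {γ : ℝ} (hγ : -1 < γ) {n : ℕ}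
    {F : WeightedL2 γ} (hF : F ∈ polyBergman γ n)
    (h : ∀ G ∈ discPolySpan hγ n, inner ℂ G F = 0) : F = 0 := by
  obtain ⟨f, hf, hFf⟩ := hF
  obtain ⟨c, hc⟩ := hf.exists_hasExpansion
  have h1 : ∀ e, componentL2 hγ n c e = 0 := by
    intro e
    rw [← inner_self_eq_zero (𝕜 := ℂ), ← inner_componentL2 hγ hc hFf]
    refine h _ ?_
    rw [componentL2_eq_sum]
    exact Submodule.sum_mem _ fun k hk => Submodule.smul_mem _ _
      (monomialL2_mem_discPolySpan hγ (Nat.lt_succ_iff.1 (Finset.mem_range.1 hk)))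
  obtain ⟨C, -, hC⟩ := exists_norm_shiftCoeff_le hγ (r := 1 / 2) (by norm_num) (by norm_num) n
  have h2 : ∀ k ≤ n, ∀ a, c k a = 0 := by
    intro k hk a
    have h3 := hC c (a + n - k) k hk
    rw [h1, norm_zero, mul_zero, shiftCoeff_add_sub c a hk] at h3
    have h4 : (0 : ℝ) < (1 / 2) ^ (a + n - k) := by positivity
    have h5 : ‖c k a‖ ≤ 0 := nonpos_of_mul_nonpos_right h3 h4
    exact norm_le_zero_iff.1 h5
  refine Lp.ext (hFf.trans ?_)
  filter_upwards [ae_mem_disc γ, Lp.coeFn_zero ℂ 2 (diskMeasure γ)] with z hz hz0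
  rw [hc.2 z hz, hz0, Pi.zero_apply]
  refine Finset.sum_eq_zero fun k hk => ?_
  simp [h2 k (Nat.lt_succ_iff.1 (Finset.mem_range.1 hk))]

theorem HasExpansion.sub {n : ℕ} {c d : ℕ → ℕ → ℂ} {f g : ℂ → ℂ} (hf : HasExpansion n c f)
    (hg : HasExpansion n d g) : HasExpansion n (c - d) (f - g) := by
  have e : ∀ k (z : ℂ), (fun a => (c - d) k a * z ^ a) = fun a => c k a * z ^ a - d k a * z ^ a :=
    fun k z => funext fun a => by simp only [Pi.sub_apply, sub_mul]
  refine ⟨fun k z hz => ?_, fun z hz => ?_⟩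
  · rw [e]
    exact (hf.1 k z hz).sub (hg.1 k z hz)
  · rw [Pi.sub_apply, hf.2 z hz, hg.2 z hz, ← Finset.sum_sub_distrib]
    refine Finset.sum_congr rfl fun k _ => ?_
    rw [e, (hf.1 k z hz).tsum_sub (hg.1 k z hz), mul_sub]

theorem norm_mul_pow_le_of_le {c : ℕ → ℂ} {r M : ℝ} (hr : 0 < r)
    (h : ∀ a, ‖c a‖ * r ^ a ≤ M) (z : ℂ) (a : ℕ) : ‖c a * z ^ a‖ ≤ M * (‖z‖ / r) ^ a := by
  have h1 : ‖c a * z ^ a‖ = ‖c a‖ * r ^ a * (‖z‖ / r) ^ a := by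
    rw [norm_mul, norm_pow, div_pow]
    field_simp
  rw [h1]
  exact mul_le_mul_of_nonneg_right (h a) (by positivity)

theorem isClosed_polyBergman {γ : ℝ} (hγ : -1 < γ) (n : ℕ) :
    IsClosed (polyBergman γ n : Set (WeightedL2 γ)) := by
  refine IsSeqClosed.isClosed fun u F hu huF => ?_
  choose f hf huf using hu
  choose c hc using fun j => (hf j).exists_hasExpansion
  have hsub : ∀ i j, ⇑(u i - u j) =ᵐ[diskMeasure γ] f i - f j := fun i j =>
    (Lp.coeFn_sub _ _).trans ((huf i).sub (huf j))
  have hlim : ∀ k ≤ n, ∀ a, ∃ x, Filter.Tendsto (fun j => c j k a) Filter.atTop (nhds x) := by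
    intro k hk a
    obtain ⟨C, hC0, hC⟩ := exists_norm_coeff_le hγ (r := 1 / 2) (by norm_num) (by norm_num) n
    refine cauchySeq_tendsto_of_complete (Metric.cauchySeq_iff.2 fun ε hε => ?_)
    -- `C + 1` rather than `C`, which may be zero.
    have hδ : 0 < ε * (1 / 2) ^ a / (C + 1) := by positivity
    obtain ⟨N, hN⟩ := Metric.cauchySeq_iff.1 huF.cauchySeq _ hδ
    refine ⟨N, fun i hi j hj => ?_⟩
    have h1 := hC _ _ _ ((hc i).sub (hc j)) (hsub i j) a k hk
    have h2 := hN i hi j hj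
    rw [dist_eq_norm, lt_div_iff₀ (by positivity)] at h2
    rw [dist_eq_norm]
    simp only [Pi.sub_apply] at h1
    have h3 : ‖c i k a - c j k a‖ * (1 / 2) ^ a < ε * (1 / 2) ^ a := by
      nlinarith [norm_nonneg (u i - u j)]
    exact lt_of_mul_lt_mul_right h3 (by positivity)
  choose! d₀ hd₀ using hlim
  -- `HasExpansion` requires summability for every `k`, hence the value `0` beyond `n`.
  let d : ℕ → ℕ → ℂ := fun k a => if k ≤ n then d₀ k a else 0
  have hd : ∀ k ≤ n, ∀ a, Filter.Tendsto (fun j => c j k a) Filter.atTop (nhds (d k a)) := by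
    intro k hk a
    simpa [d, hk] using hd₀ k hk a
  have hbound : ∀ r : ℝ, 0 < r → r < 1 → ∃ C, ∀ k ≤ n, ∀ j a,
      ‖(c j k - d k) a‖ * r ^ a ≤ C * ‖u j - F‖ := by
    intro r hr0 hr1
    obtain ⟨C, -, hC⟩ := exists_norm_coeff_le hγ hr0 hr1 n
    refine ⟨C, fun k hk j a => ?_⟩
    -- Let `i → ∞` in the coefficient bound for `u j - u i`.
    refine le_of_tendsto_of_tendsto' ((((tendsto_const_nhds (x := c j k a)).sub
      (hd k hk a)).norm).mul_const (r ^ a))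
      ((((tendsto_const_nhds (x := u j)).sub huF).norm).const_mul C) fun i => ?_
    exact hC _ _ _ ((hc j).sub (hc i)) (hsub j i) a k hk
  have hgeom : ∀ z ∈ disc, ∃ M, ∀ k ≤ n, ∀ j,
      Summable (fun a => (c j k - d k) a * z ^ a) ∧
        ‖∑' a, (c j k - d k) a * z ^ a‖ ≤ M * ‖u j - F‖ := by
    intro z hz
    have hz1 : ‖z‖ < 1 := by simpa using hz
    -- With `‖z‖ < r < 1`, the bound at `r` yields a geometric majorant of ratio `‖z‖ / r`.
    obtain ⟨r, hzr, hr1⟩ := exists_between hz1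
    have hr0 : 0 < r := (norm_nonneg z).trans_lt hzr
    obtain ⟨C, hC⟩ := hbound r hr0 hr1
    have hq := hasSum_geometric_of_lt_one (r := ‖z‖ / r) (by positivity)
      ((div_lt_one hr0).2 hzr)
    refine ⟨C * (1 - ‖z‖ / r)⁻¹, fun k hk j => ?_⟩
    have h1 := norm_mul_pow_le_of_le hr0 (hC k hk j) z
    have h2 := hq.mul_left (C * ‖u j - F‖)
    refine ⟨Summable.of_norm_bounded h2.summable h1, ?_⟩
    refine (tsum_of_norm_bounded h2 h1).trans (le_of_eq (by ring))
  have hds : ∀ k, ∀ z ∈ disc, Summable fun a => d k a * z ^ a := by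
    intro k z hz
    by_cases hk : k ≤ n
    · obtain ⟨M, hM⟩ := hgeom z hz
      refine (((hc 0).1 k z hz).sub (hM k hk 0).1).congr fun a => ?_
      simp only [Pi.sub_apply]
      ring
    · simp [d, hk, summable_zero]
  let g : ℂ → ℂ := fun z => ∑ k ∈ Finset.range (n + 1), conj z ^ k * ∑' a, d k a * z ^ a
  have hg : HasExpansion n d g := ⟨hds, fun z _ => rfl⟩
  have hu0 : Filter.Tendsto (fun j => ‖u j - F‖) Filter.atTop (nhds 0) :=
    tendsto_iff_norm_sub_tendsto_zero.1 huF
  have hptw : ∀ z ∈ disc, Filter.Tendsto (fun j => f j z) Filter.atTop (nhds (g z)) := by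
    intro z hz
    obtain ⟨M, hM⟩ := hgeom z hz
    have e : ∀ j, f j z = ∑ k ∈ Finset.range (n + 1), conj z ^ k * ∑' a, c j k a * z ^ a :=
      fun j => (hc j).2 z hz
    simp only [e]
    refine tendsto_finsetSum _ fun k hk => Filter.Tendsto.const_mul _ ?_
    have hk' : k ≤ n := Nat.lt_succ_iff.1 (Finset.mem_range.1 hk)
    refine tendsto_iff_norm_sub_tendsto_zero.2 (squeeze_zero (fun _ => norm_nonneg _) (fun j => ?_)
      (by simpa using hu0.const_mul M))
    rw [← ((hc j).1 k z hz).tsum_sub (hds k z hz)]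
    simpa only [Pi.sub_apply, sub_mul] using (hM k hk' j).2
  -- A subsequence converges a.e. to `F`, while the whole sequence converges pointwise to `g` on the
  -- disc.
  obtain ⟨ns, hns, hae⟩ := (tendstoInMeasure_of_tendsto_Lp huF).exists_seq_tendsto_ae
  refine ⟨g, hg.isPolyanalytic, ?_⟩
  filter_upwards [hae, ae_all_iff.2 huf, ae_mem_disc γ] with z h1 h2 h3
  simp only [h2] at h1
  exact tendsto_nhds_unique h1 ((hptw z h3).comp hns.tendsto_atTop)

theorem polyBergman_eq_topologicalClosure {γ : ℝ} (hγ : -1 < γ) (n : ℕ) :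
    polyBergman γ n = (discPolySpan hγ n).topologicalClosure := by
  have hle : (discPolySpan hγ n).topologicalClosure ≤ polyBergman γ n :=
    Submodule.topologicalClosure_minimal _ (discPolySpan_le_polyBergman hγ n)
      (isClosed_polyBergman hγ n)
  have : CompleteSpace (discPolySpan hγ n).topologicalClosure :=
    (discPolySpan hγ n).isClosed_topologicalClosure.completeSpace_coe
  -- The poly-Bergman space is the closure plus the part of it orthogonal to the closure, and that
  -- part is zero.
  have h := Submodule.sup_orthogonal_inf_of_hasOrthogonalProjection hle
  have hbot : (discPolySpan hγ n).topologicalClosureᗮ ⊓ polyBergman γ n = ⊥ := by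
    refine (Submodule.eq_bot_iff _).2 fun F hF => ?_
    refine eq_zero_of_mem_polyBergman_of_orthogonal hγ hF.2 fun G hG => ?_
    exact (Submodule.mem_orthogonal _ _).1 hF.1 G (Submodule.le_topologicalClosure _ hG)
  rw [hbot, sup_bot_eq] at h
  exact h.symm

end PolyBergman

theorem theorem1 (γ : ℝ) (hγ : -1 < γ) (n : ℕ) :
    IsClosed (PolyBergman.polyBergman γ n : Set (PolyBergman.WeightedL2 γ)) ∧
      PolyBergman.polyBergman γ n =
        (Submodule.span ℂ
          {F : PolyBergman.WeightedL2 γ |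
            ∃ m k : ℕ, k ≤ n ∧ F = PolyBergman.discPolyL2 hγ m k}).topologicalClosure :=
  ⟨PolyBergman.isClosed_polyBergman hγ n, PolyBergman.polyBergman_eq_topologicalClosure hγ n⟩
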